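/- Let $g\geq 3$ be an integer. Let $\Lambda_1$ and $\Lambda_2$ be free abelian groups of rank $2$ and $2g-2$, respectively. For $i=1,2$ let $S_i\colon\Lambda_i\times\Lambda_i\to\mathbb Z$ be a positive-definite symmetric bilinear form, and let $J_i\in\mathrm{End}(\Lambda_i)$ satisfy $J_i^2=-\mathrm{Id}$ and $J_i\in \mathrm{SO}(\Lambda_{i,\mathbb R},S_i)$, i.e. the $\mathbb R$-linear extension of $J_i$ to $\Lambda_{i,\mathbb R}=\Lambda_i\otimes_{\mathbb Z}\mathbb R$ preserves $S_i$ and has determinant $1$. Let $\Lambda=\Lambda_1\oplus\Lambda_2$, let $S$ be the symmetric bilinear form on $\Lambda$ which is the orthogonal direct sum of $-S_1$ and $S_2$, and let $J_0=J_1\oplus J_2\in\mathrm{End}(\Lambda)$. Write $\Lambda_{\mathbb Q}=\Lambda\otimes_{\mathbb Z}\mathbb Q$ and $\Lambda_{\mathbb R}=\Lambda\otimes_{\mathbb Z}\mathbb R$, and denote the scalar extensions of $S$ and $J_0$ by the same letters. Then there is an element $J\in \mathrm{SO}(\Lambda_{\mathbb R},S)$ such that $J^2=-1$, the centraliser $\{u\in\mathrm{End}(\Lambda_{\mathbb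 Q}) : uJ=Ju \text{ in } \mathrm{End}(\Lambda_{\mathbb R})\}$ of $J$ in $\mathrm{End}(\Lambda_{\mathbb Q})$ is $\mathbb Q\,\mathrm{Id}_\Lambda+\mathbb Q J_0$, and the bilinear form $(x,y)\mapsto S(Jx,J_0y)$ on $\Lambda_{\mathbb R}$ is symmetric and positive-definite. -/

import Mathlib

open scoped TensorProduct

noncomputable section

/-- A symmetric, positive-definite bilinear form over an ordered ring. -/
def IsSymmPosDef {R M : Type*} [CommRing R] [LinearOrder R] [AddCommGroup M] [Module R M]
    (B : LinearMap.BilinForm R M) : Prop :=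
  B.IsSymm ∧ ∀ x : M, x ≠ 0 → 0 < B x x

/-- The special orthogonal group of a bilinear form `B`, as a subset of the endomorphism ring. -/
def specialOrthogonalSet {R M : Type*} [CommRing R] [AddCommGroup M] [Module R M]
    (B : LinearMap.BilinForm R M) : Set (Module.End R M) :=
  {f | (∀ x y : M, B (f x) (f y) = B x y) ∧ LinearMap.det f = 1}

/-- The orthogonal direct sum of two bilinear forms. -/
def orthogonalSum {R M₁ M₂ : Type*} [CommRing R] [AddCommGroup M₁] [Module R M₁]
    [AddCommGroup M₂] [Module R M₂]
    (B₁ : LinearMap.BilinForm R M₁) (B₂ : LinearMap.BilinForm R M₂) :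
    LinearMap.BilinForm R (M₁ × M₂) :=
  B₁.compl₁₂ (LinearMap.fst R M₁ M₂) (LinearMap.fst R M₁ M₂) +
    B₂.compl₁₂ (LinearMap.snd R M₁ M₂) (LinearMap.snd R M₁ M₂)

/-- The natural map from endomorphisms of `ℚ ⊗ L` to endomorphisms of `ℝ ⊗ L`: extension of
scalars along `ℚ → ℝ`, transported along the canonical isomorphism `ℝ ⊗ (ℚ ⊗ L) ≃ ℝ ⊗ L`. -/
def ratEndToReal {L : Type*} [AddCommGroup L] (u : Module.End ℚ (ℚ ⊗[ℤ] L)) :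
    Module.End ℝ (ℝ ⊗[ℤ] L) :=
  (TensorProduct.AlgebraTensorModule.cancelBaseChange ℤ ℚ ℝ ℝ L).conj (u.baseChange ℝ)

/-- The centraliser of a real endomorphism `J` of `ℝ ⊗ L` in `End (ℚ ⊗ L)`. -/
def rationalCentraliser {L : Type*} [AddCommGroup L] (J : Module.End ℝ (ℝ ⊗[ℤ] L)) :
    Set (Module.End ℚ (ℚ ⊗[ℤ] L)) :=
  {u | ratEndToReal u * J = J * ratEndToReal u}

end

/-!
Reversing `J₀` on a negative complex line `ℂ v` of `Λ_ℝ` gives a complex structure `lineFlip v`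
which preserves `S` and makes `S (J x, J₀ y)` positive-definite. Commuting with `lineFlip v` is a
system of homogeneous quadratic equations in `v`, so by Baire category `v` can be chosen such that
each of the countably many rational endomorphisms commuting with `lineFlip v` commutes with
`lineFlip w` for every non-isotropic `w`. In complex dimension at least three these flips generate
`J₀`, through `J_u + J_v + J_w + J_u J_v J_w = 2 J₀` for orthogonal `u`, `v`, `w`; so such an
endomorphism is complex linear, has every non-isotropic vector as an eigenvector, and is therefore a
complex scalar `a + b J₀`. Being rational, it has rational `a` and `b`.
-/

section Hermitian

variable {𝕜 V : Type*} [Field 𝕜] [AddCommGroup V] [Module 𝕜 V]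

/-- `B` and `I` are the real part and the multiplication by the imaginary unit of a Hermitian form
on a complex vector space, presented over an arbitrary field in place of the real numbers. -/
structure IsHermitianPair (B : LinearMap.BilinForm 𝕜 V) (I : Module.End 𝕜 V) : Prop where
  symm : B.IsSymm
  sq : I * I = -1
  isometry : ∀ x y, B (I x) (I y) = B x y

/-- Orthogonality for the Hermitian form with real part `B`: its imaginary part at `v` and `w` is,
up to sign, `B (I v) w`. -/
def IsHermOrtho (B : LinearMap.BilinForm 𝕜 V) (I : Module.End 𝕜 V) (v w : V) : Prop :=
  B v w = 0 ∧ B (I v) w = 0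

/-- The complex structure which is `-I` on the complex line through `v` and `I` on the orthogonal
complement of that line. If `B v v = 0` it has the junk value `I`. -/
def lineFlip (B : LinearMap.BilinForm 𝕜 V) (I : Module.End 𝕜 V) (v : V) : Module.End 𝕜 V :=
  I - (2 / B v v) • ((B v).smulRight (I v) - (B (I v)).smulRight v)

/-- The bilinear extension of `v ↦ B v v • lineFlip B I v`; it expresses commutation with
`lineFlip B I v` as a quadratic condition on `v`. -/
def lineFlipForm (B : LinearMap.BilinForm 𝕜 V) (I : Module.End 𝕜 V) :
    V →ₗ[𝕜] V →ₗ[𝕜] Module.End 𝕜 V :=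
  LinearMap.mk₂ 𝕜
    (fun v w => B v w • I - (2 : 𝕜) • ((B v).smulRight (I w) - (B (I v)).smulRight w))
    (fun v₁ v₂ w => by ext; simp; module) (fun c v w => by ext; simp; module)
    (fun v w₁ w₂ => by ext; simp; module) (fun c v w => by ext; simp; module)

variable {B : LinearMap.BilinForm 𝕜 V} {I : Module.End 𝕜 V}

theorem lineFlip_apply (v x : V) :
    lineFlip B I v x = I x - (2 / B v v) • (B v x • I v - B (I v) x • v) := by
  simp [lineFlip]

theorem lineFlipForm_apply_self {v : V} (hv : B v v ≠ 0) :
    lineFlipForm B I v v = B v v • lineFlip B I v := by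
  simp [lineFlipForm, lineFlip, smul_sub, smul_smul, mul_div_cancel₀ _ hv]

namespace IsHermitianPair

theorem apply_apply (h : IsHermitianPair B I) (x : V) : I (I x) = -x := by
  simpa using LinearMap.congr_fun h.sq x

theorem apply_right (h : IsHermitianPair B I) (x y : V) : B x (I y) = -B (I x) y := by
  rw [← h.isometry x (I y), h.apply_apply, map_neg]

theorem lineFlip_commute (h : IsHermitianPair B I) (v : V) : Commute I (lineFlip B I v) := by
  ext x
  simp only [Module.End.mul_apply, lineFlip_apply, map_sub, map_smul, h.apply_apply,
    h.apply_right, map_neg, LinearMap.neg_apply]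
  module

theorem isHermOrtho_symm (h : IsHermitianPair B I) {v w : V} (hvw : IsHermOrtho B I v w) :
    IsHermOrtho B I w v :=
  ⟨by rw [h.symm.eq, hvw.1], by rw [h.symm.eq, h.apply_right, hvw.2, neg_zero]⟩

theorem apply_lineFlip (h : IsHermitianPair B I) (v x y : V) :
    B (lineFlip B I v x) (I y) = B x y - 2 / B v v * (B v x * B v y + B (I v) x * B (I v) y) := by
  simp only [lineFlip_apply, map_sub, map_smul, LinearMap.sub_apply, LinearMap.smul_apply,
    smul_eq_mul, h.isometry, h.apply_right]
  ring

/-- On each of the three lines the sum is `(-I + I + I) + I`, and on their common orthogonal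
complement it is `(I + I + I) - I`. -/
theorem lineFlip_add_add_add_mul (h : IsHermitianPair B I) {u v w : V} (hu : B u u ≠ 0)
    (hv : B v v ≠ 0) (hw : B w w ≠ 0) (huv : IsHermOrtho B I u v) (huw : IsHermOrtho B I u w)
    (hvw : IsHermOrtho B I v w) :
    lineFlip B I u + lineFlip B I v + lineFlip B I w +
      lineFlip B I u * lineFlip B I v * lineFlip B I w = (2 : 𝕜) • I := by
  ext x
  simp only [LinearMap.add_apply, LinearMap.smul_apply, Module.End.mul_apply, lineFlip_apply,
    map_sub, map_smul, h.apply_apply, h.apply_right, map_neg,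
    LinearMap.neg_apply, huv.1, huv.2, huw.1, huw.2, hvw.1, hvw.2]
  match_scalars <;> field_simp <;> ring

theorem apply_smul_add_smul_of_isHermOrtho (h : IsHermitianPair B I) {v w : V}
    (hvw : IsHermOrtho B I v w) (a b c d : 𝕜) :
    B (a • v + b • I v) (c • w + d • I w) = 0 := by
  simp [hvw.1, hvw.2, h.apply_right, h.apply_apply]

variable [CharZero 𝕜]

theorem apply_left_self (h : IsHermitianPair B I) (x : V) : B (I x) x = 0 := by
  have hskew : (2 : 𝕜) * B (I x) x = 0 := by
    linear_combination h.symm.eq (I x) x + h.apply_right x x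
  exact (mul_eq_zero.1 hskew).resolve_left two_ne_zero

theorem apply_right_self (h : IsHermitianPair B I) (x : V) : B x (I x) = 0 := by
  rw [h.symm.eq, h.apply_left_self]

theorem lineFlip_isometry (h : IsHermitianPair B I) {v : V} (hv : B v v ≠ 0) (x y : V) :
    B (lineFlip B I v x) (lineFlip B I v y) = B x y := by
  simp only [lineFlip_apply, map_sub, map_smul, LinearMap.sub_apply, LinearMap.smul_apply,
    smul_eq_mul, h.isometry, h.apply_left_self, h.apply_right_self]
  rw [h.symm.eq (I x) v, h.apply_right v x, h.symm.eq x v, h.apply_right v y]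
  field_simp
  ring

theorem lineFlip_mul_self (h : IsHermitianPair B I) {v : V} (hv : B v v ≠ 0) :
    lineFlip B I v * lineFlip B I v = -1 := by
  ext x
  simp only [Module.End.mul_apply, lineFlip_apply, map_sub, map_smul, h.apply_apply,
    h.apply_right, h.apply_left_self, LinearMap.neg_apply, Module.End.one_apply, map_neg]
  match_scalars <;> field_simp <;> ring

theorem apply_smul_add_smul_self (h : IsHermitianPair B I) (a b : 𝕜) (v : V) :
    B (a • v + b • I v) (a • v + b • I v) = (a ^ 2 + b ^ 2) * B v v := by
  simp only [map_add, map_smul, LinearMap.add_apply, LinearMap.smul_apply, smul_eq_mul,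
    h.isometry, h.apply_left_self, h.apply_right_self]
  ring

theorem exists_eq_add_isHermOrtho (h : IsHermitianPair B I) {v : V} (hv : B v v ≠ 0) (x : V) :
    ∃ (a b : 𝕜) (y : V), IsHermOrtho B I v y ∧ x = a • v + b • I v + y := by
  refine ⟨B v x / B v v, B (I v) x / B v v, x - (B v x / B v v) • v - (B (I v) x / B v v) • I v,
    ⟨?_, ?_⟩, by module⟩ <;>
  simp [h.apply_left_self, h.apply_right_self, h.isometry, hv]

theorem commute_of_commute_lineFlip (h : IsHermitianPair B I) {T : Module.End 𝕜 V} {u v w : V}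
    (hu : B u u ≠ 0) (hv : B v v ≠ 0) (hw : B w w ≠ 0) (huv : IsHermOrtho B I u v)
    (huw : IsHermOrtho B I u w) (hvw : IsHermOrtho B I v w)
    (hTu : Commute T (lineFlip B I u)) (hTv : Commute T (lineFlip B I v))
    (hTw : Commute T (lineFlip B I w)) : Commute T I := by
  have hsum := ((hTu.add_right hTv).add_right hTw).add_right ((hTu.mul_right hTv).mul_right hTw)
  rw [h.lineFlip_add_add_add_mul hu hv hw huv huw hvw] at hsum
  simpa using hsum.smul_right (2⁻¹ : 𝕜)

theorem lineFlip_apply_add (h : IsHermitianPair B I) {v y : V} (hv : B v v ≠ 0)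
    (hy : IsHermOrtho B I v y) (a b : 𝕜) :
    lineFlip B I v (a • v + b • I v + y) = I (y - (a • v + b • I v)) := by
  simp only [lineFlip_apply, map_add, map_sub, map_smul, hy.1, hy.2, h.apply_left_self,
    h.apply_right_self, h.isometry, h.apply_apply]
  match_scalars <;> field_simp <;> ring

theorem exists_apply_eq_of_commute (h : IsHermitianPair B I) {T : Module.End 𝕜 V} {v : V}
    (hv : B v v ≠ 0) (hTI : Commute T I) (hTv : Commute T (lineFlip B I v)) :
    ∃ a b : 𝕜, T v = a • v + b • I v := by
  obtain ⟨a, b, y, hy, hdecomp⟩ := h.exists_eq_add_isHermOrtho hv (T v)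
  have hflip : lineFlip B I v v = -I v := by
    simpa using h.lineFlip_apply_add hv (y := 0) ⟨map_zero _, map_zero _⟩ 1 0
  have heigen : lineFlip B I v (T v) = -I (T v) := by
    calc lineFlip B I v (T v) = T (lineFlip B I v v) := (LinearMap.congr_fun hTv.eq v).symm
      _ = -T (I v) := by rw [hflip, map_neg]
      _ = -I (T v) := congrArg Neg.neg (LinearMap.congr_fun hTI.eq v)
  rw [hdecomp, h.lineFlip_apply_add hv hy, ← map_neg] at heigen
  have hy0 : y = 0 := by
    have hII := congrArg I heigen
    rw [h.apply_apply, h.apply_apply, neg_inj, ← sub_eq_zero] at hII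
    refine (smul_eq_zero.1 (?_ : (2 : 𝕜) • y = 0)).resolve_left two_ne_zero
    rw [← hII]
    module
  exact ⟨a, b, by rw [hdecomp, hy0, add_zero]⟩

theorem apply_eq_zero_of_commute (h : IsHermitianPair B I) {T : Module.End 𝕜 V} {e v : V}
    (hv : B v v ≠ 0) (hve : B v e ≠ 0) (hIve : B (I v) e = 0) (hTI : Commute T I)
    (hTv : Commute T (lineFlip B I v)) (hTe : T e = 0) : T v = 0 := by
  have hcomm : ∀ x, T (I x) = I (T x) := LinearMap.congr_fun hTI.eq
  have hflip : (2 / B v v * B v e) • I (T v) = 0 := by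
    simpa [lineFlip_apply, hcomm, hTe, hIve, smul_smul] using LinearMap.congr_fun hTv.eq e
  have hITv : I (T v) = 0 :=
    (smul_eq_zero.1 hflip).resolve_left (mul_ne_zero (div_ne_zero two_ne_zero hv) hve)
  simpa [hITv] using h.apply_apply (T v)

theorem exists_ne_zero_apply_add_smul_self_ne_zero (h : IsHermitianPair B I) {e y : V}
    (he : B e e ≠ 0) (hey : IsHermOrtho B I e y) :
    ∃ t : 𝕜, t ≠ 0 ∧ B (y + t • e) (y + t • e) ≠ 0 := by
  have hexpand (t : 𝕜) : B (y + t • e) (y + t • e) = B y y + t ^ 2 * B e e := by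
    simp only [map_add, map_smul, LinearMap.add_apply, LinearMap.smul_apply, smul_eq_mul, hey.1,
      (h.isHermOrtho_symm hey).1]
    ring
  by_contra! hzero
  have h₁ := hzero 1 one_ne_zero
  have h₂ := hzero 2 two_ne_zero
  rw [hexpand] at h₁ h₂
  have h₃ : (3 : 𝕜) * B e e = 0 := by linear_combination h₂ - h₁
  exact he ((mul_eq_zero.1 h₃).resolve_left three_ne_zero)

theorem eq_zero_of_commute (h : IsHermitianPair B I) {T : Module.End 𝕜 V} {e : V}
    (he : B e e ≠ 0) (hTI : Commute T I) (hT : ∀ v, B v v ≠ 0 → Commute T (lineFlip B I v))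
    (hTe : T e = 0) : T = 0 := by
  have hTIe : T (I e) = 0 := by simpa [hTe] using LinearMap.congr_fun hTI.eq e
  have hcompl (y : V) (hy : IsHermOrtho B I e y) : T y = 0 := by
    obtain ⟨t, ht, hv⟩ := h.exists_ne_zero_apply_add_smul_self_ne_zero he hy
    have hye := h.isHermOrtho_symm hy
    have hve : B (y + t • e) e ≠ 0 := by simpa [hye.1] using ⟨ht, he⟩
    have hIve : B (I (y + t • e)) e = 0 := by simp [hye.2, h.apply_left_self]
    simpa [hTe] using h.apply_eq_zero_of_commute hv hve hIve hTI (hT _ hv) hTe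
  ext x
  obtain ⟨a, b, y, hy, rfl⟩ := h.exists_eq_add_isHermOrtho he x
  simp [hTe, hTIe, hcompl y hy]

theorem exists_eq_smul_one_add_smul (h : IsHermitianPair B I) {T : Module.End 𝕜 V} {u v w : V}
    (hu : B u u ≠ 0) (hv : B v v ≠ 0) (hw : B w w ≠ 0) (huv : IsHermOrtho B I u v)
    (huw : IsHermOrtho B I u w) (hvw : IsHermOrtho B I v w)
    (hT : ∀ x, B x x ≠ 0 → Commute T (lineFlip B I x)) : ∃ a b : 𝕜, T = a • 1 + b • I := by
  have hTI : Commute T I :=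
    h.commute_of_commute_lineFlip hu hv hw huv huw hvw (hT u hu) (hT v hv) (hT w hw)
  obtain ⟨a, b, hTu⟩ := h.exists_apply_eq_of_commute hu hTI (hT u hu)
  refine ⟨a, b, sub_eq_zero.1 (h.eq_zero_of_commute hu ?_ (fun x hx => ?_) ?_)⟩
  · exact hTI.sub_left (((Commute.one_left I).smul_left a).add_left ((Commute.refl I).smul_left b))
  · exact (hT x hx).sub_left
      (((Commute.one_left _).smul_left a).add_left ((h.lineFlip_commute x).smul_left b))
  · simp [hTu]

end IsHermitianPair

end Hermitian

section Lorentzian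

variable {𝕜 V : Type*} [Field 𝕜] [LinearOrder 𝕜] [AddCommGroup V] [Module 𝕜 V]

/-- The Hermitian form with real part `B` is Lorentzian: it is negative-definite on some complex
line and positive-definite on the orthogonal complement of that line. -/
structure IsLorentzian (B : LinearMap.BilinForm 𝕜 V) (I : Module.End 𝕜 V) : Prop
    extends IsHermitianPair B I where
  exists_neg : ∃ e, B e e < 0 ∧ ∀ y, IsHermOrtho B I e y → y ≠ 0 → 0 < B y y

variable {B : LinearMap.BilinForm 𝕜 V} {I : Module.End 𝕜 V}

namespace IsLorentzian

theorem exists_isHermOrtho_triple (h : IsLorentzian B I) (hd : 5 ≤ Module.finrank 𝕜 V) :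
    ∃ u v w, B u u ≠ 0 ∧ B v v ≠ 0 ∧ B w w ≠ 0 ∧
      IsHermOrtho B I u v ∧ IsHermOrtho B I u w ∧ IsHermOrtho B I v w := by
  have : FiniteDimensional 𝕜 V := Module.finite_of_finrank_pos (by omega)
  obtain ⟨e, he, hpos⟩ := h.exists_neg
  have hexists (x : V) : ∃ y, y ≠ 0 ∧ IsHermOrtho B I e y ∧ IsHermOrtho B I x y := by
    obtain ⟨y, hy, hy0⟩ := Submodule.exists_mem_ne_zero_of_ne_bot
      (LinearMap.ker_ne_bot_of_finrank_lt
        (f := ((B e).prod (B (I e))).prod ((B x).prod (B (I x)))) (by simp; omega))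
    simp only [LinearMap.ker_prod, Submodule.mem_inf, LinearMap.mem_ker] at hy
    exact ⟨y, hy0, hy.1, hy.2⟩
  obtain ⟨v, hv0, hev, -⟩ := hexists e
  obtain ⟨w, hw0, hew, hvw⟩ := hexists v
  exact ⟨e, v, w, he.ne, (hpos v hev hv0).ne', (hpos w hew hw0).ne', hev, hew, hvw⟩

variable [IsStrictOrderedRing 𝕜]

/-- Otherwise the complex span of `v` and `x` would be a negative-semidefinite plane, which meets
the positive-definite orthogonal complement of a negative vector `e` in the vector `w`. -/
theorem pos_of_isHermOrtho (h : IsLorentzian B I) {v x : V} (hv : B v v < 0)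
    (hvx : IsHermOrtho B I v x) (hx : x ≠ 0) : 0 < B x x := by
  obtain ⟨e, -, hpos⟩ := h.exists_neg
  by_contra! hBx
  set w := (B e x • v + B (I e) x • I v) - (B e v • x + B (I e) v • I x) with hw
  have hew : IsHermOrtho B I e w := by
    constructor <;> simp [hw, h.apply_right, h.apply_apply] <;> ring
  have hBw : B w w = (B e x ^ 2 + B (I e) x ^ 2) * B v v +
      (B e v ^ 2 + B (I e) v ^ 2) * B x x := by
    rw [← h.apply_smul_add_smul_self, ← h.apply_smul_add_smul_self, hw, map_sub B,
      LinearMap.sub_apply, map_sub (B _), map_sub (B _), h.apply_smul_add_smul_of_isHermOrtho hvx,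
      h.apply_smul_add_smul_of_isHermOrtho (h.isHermOrtho_symm hvx)]
    ring
  have hBw_nonneg : 0 ≤ B w w := by
    rcases eq_or_ne w 0 with hw0 | hw0
    · simp [hw0]
    · exact (hpos w hew hw0).le
  have hBx_nonpos : (B e v ^ 2 + B (I e) v ^ 2) * B x x ≤ 0 :=
    mul_nonpos_of_nonneg_of_nonpos (by positivity) hBx
  have hsq : B e x ^ 2 + B (I e) x ^ 2 = 0 := by
    nlinarith [sq_nonneg (B e x), sq_nonneg (B (I e) x)]
  have hex : IsHermOrtho B I e x := by
    constructor <;> nlinarith [sq_nonneg (B e x), sq_nonneg (B (I e) x)]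
  exact (hpos x hex hx).not_ge hBx

theorem isSymmPosDef_lineFlip (h : IsLorentzian B I) {v : V} (hv : B v v < 0) :
    IsSymmPosDef (B.compl₁₂ (lineFlip B I v) I) := by
  refine ⟨⟨fun x y => ?_⟩, fun x hx => ?_⟩
  · simp only [LinearMap.compl₁₂_apply, h.apply_lineFlip]
    rw [h.symm.eq x y]
    ring
  · obtain ⟨a, b, y, hy, rfl⟩ := h.exists_eq_add_isHermOrtho hv.ne x
    have hvy : B (a • v + b • I v) y = 0 := by
      simpa using h.apply_smul_add_smul_of_isHermOrtho hy a b 1 0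
    have hvalue : B (lineFlip B I v (a • v + b • I v + y)) (I (a • v + b • I v + y)) =
        B y y - (a ^ 2 + b ^ 2) * B v v := by
      rw [h.lineFlip_apply_add hv.ne hy, h.isometry, ← h.apply_smul_add_smul_self, map_sub B,
        LinearMap.sub_apply, map_add (B y) _ y, map_add (B _) _ y, hvy, h.symm.eq y, hvy]
      ring
    rw [LinearMap.compl₁₂_apply, hvalue]
    rcases eq_or_ne y 0 with rfl | hy0
    · have hab : 0 < a ^ 2 + b ^ 2 := by
        by_contra! hle
        have ha : a = 0 := by nlinarith [sq_nonneg a, sq_nonneg b]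
        have hb : b = 0 := by nlinarith [sq_nonneg a, sq_nonneg b]
        exact hx (by simp [ha, hb])
      simpa using mul_neg_of_pos_of_neg hab hv
    · nlinarith [h.pos_of_isHermOrtho hv hy hy0, sq_nonneg a, sq_nonneg b]

end IsLorentzian

end Lorentzian

section Genericity

variable {V W : Type*} [AddCommGroup V] [Module ℝ V] [AddCommGroup W] [Module ℝ W]

/-- The second difference of `v ↦ Q v v` in the direction `w` is `2 • Q w w` at every point. -/
theorem apply_self_eq_zero_of_mem_interior [TopologicalSpace V] [ContinuousAdd V]
    [ContinuousSMul ℝ V] {Q : V →ₗ[ℝ] V →ₗ[ℝ] W} {z : V}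
    (hz : z ∈ interior {v | Q v v = 0}) (w : V) : Q w w = 0 := by
  have hcont : Continuous fun t : ℝ => z + t • w := by fun_prop
  have hnear : ∀ᶠ t in nhds (0 : ℝ), Q (z + t • w) (z + t • w) = 0 :=
    hcont.tendsto' 0 z (by simp) (mem_interior_iff_mem_nhds.1 hz)
  obtain ⟨ε, hε, hzero⟩ := Metric.eventually_nhds_iff.1 hnear
  have hQ₀ := hzero (y := 0) (by simpa using hε)
  have hQ₁ := hzero (y := ε / 2) (by simpa [abs_of_pos hε] using hε)
  have hQ₂ := hzero (y := -(ε / 2)) (by simpa [abs_of_pos hε] using hε)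
  simp only [map_add, map_smul, LinearMap.add_apply, LinearMap.smul_apply, zero_smul,
    add_zero] at hQ₀ hQ₁ hQ₂
  have hdiff : (ε ^ 2 / 2) • Q w w = 0 := by
    linear_combination (norm := module) hQ₁ + hQ₂ - (2 : ℝ) • hQ₀
  exact (smul_eq_zero.1 hdiff).resolve_left (by positivity)

theorem dense_setOf_forall_apply_self_ne_zero [TopologicalSpace V] [ContinuousAdd V]
    [ContinuousSMul ℝ V] [BaireSpace V] [TopologicalSpace W] [T1Space W] {ι : Type*} [Countable ι]
    {Q : ι → V →ₗ[ℝ] V →ₗ[ℝ] W} (hcont : ∀ i, Continuous fun v => Q i v v)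
    (hQ : ∀ i, ∃ w, Q i w w ≠ 0) : Dense {v | ∀ i, Q i v v ≠ 0} := by
  rw [Set.ofPred_forall]
  refine dense_iInter_of_isOpen (fun i => isClosed_singleton.isOpen_compl.preimage (hcont i))
    fun i => ?_
  obtain ⟨w, hw⟩ := hQ i
  change Dense {v | Q i v v = 0}ᶜ
  rw [← interior_eq_empty_iff_dense_compl, Set.eq_empty_iff_forall_notMem]
  exact fun z hz => hw (apply_self_eq_zero_of_mem_interior hz w)

theorem exists_neg_forall_apply_self_ne_zero [FiniteDimensional ℝ V] {ι : Type*} [Countable ι]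
    {B : LinearMap.BilinForm ℝ V} (hB : ∃ v, B v v < 0) {Q : ι → V →ₗ[ℝ] V →ₗ[ℝ] W}
    (hQ : ∀ i, ∃ w, Q i w w ≠ 0) : ∃ v, B v v < 0 ∧ ∀ i, Q i v v ≠ 0 := by
  choose w hw using hQ
  choose φ hφ using fun i => Module.Projective.exists_dual_ne_zero ℝ (hw i)
  let e := (Module.finBasis ℝ V).equivFun
  have hcont (R : LinearMap.BilinForm ℝ V) : Continuous fun z => R (e.symm z) (e.symm z) :=
    (R.compl₁₂ e.symm.toLinearMap e.symm.toLinearMap).toContinuousBilinearMap.continuous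
      |>.clm_apply continuous_id
  have hdense : Dense {z | ∀ i, φ i (Q i (e.symm z) (e.symm z)) ≠ 0} :=
    dense_setOf_forall_apply_self_ne_zero
      (Q := fun i => ((Q i).compr₂ (φ i)).compl₁₂ e.symm.toLinearMap e.symm.toLinearMap)
      (fun i => hcont ((Q i).compr₂ (φ i))) fun i => ⟨e (w i), by simpa using hφ i⟩
  obtain ⟨v₀, hv₀⟩ := hB
  obtain ⟨z, hz, hzQ⟩ := hdense.inter_open_nonempty {z | B (e.symm z) (e.symm z) < 0}
    (isOpen_lt (hcont B) continuous_const) ⟨e v₀, by simpa using hv₀⟩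
  exact ⟨e.symm z, hz, fun i h0 => hzQ i (by rw [h0, map_zero])⟩

variable {B : LinearMap.BilinForm ℝ V} {I : Module.End ℝ V}

theorem exists_neg_forall_commute_lineFlip [FiniteDimensional ℝ V] {ι : Type*} [Countable ι]
    (hB : ∃ v, B v v < 0) (T : ι → Module.End ℝ V) :
    ∃ v, B v v < 0 ∧ ∀ i, Commute (T i) (lineFlip B I v) →
      ∀ w, B w w ≠ 0 → Commute (T i) (lineFlip B I w) := by
  let Q (i : ι) : V →ₗ[ℝ] V →ₗ[ℝ] Module.End ℝ V :=
    (lineFlipForm B I).compr₂ (LinearMap.mulLeft ℝ (T i) - LinearMap.mulRight ℝ (T i))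
  have hQ (i : ι) {w : V} (hw : B w w ≠ 0) :
      Q i w w = 0 ↔ Commute (T i) (lineFlip B I w) := by
    simp [Q, lineFlipForm_apply_self hw, hw, sub_eq_zero, commute_iff_eq]
  obtain ⟨v, hv, hne⟩ := exists_neg_forall_apply_self_ne_zero hB
    (Q := fun i : {i // ∃ w, Q i w w ≠ 0} => Q i) (fun i => i.2)
  refine ⟨v, hv, fun i hi w hw => (hQ i hw).1 ?_⟩
  by_contra hne_w
  exact hne ⟨i, w, hne_w⟩ ((hQ i hv.ne).2 hi)

theorem IsLorentzian.exists_neg_forall_eq_smul_one_add_smul (h : IsLorentzian B I)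
    (hd : 5 ≤ Module.finrank ℝ V) {ι : Type*} [Countable ι] (T : ι → Module.End ℝ V) :
    ∃ v, B v v < 0 ∧ ∀ i, Commute (T i) (lineFlip B I v) → ∃ a b : ℝ, T i = a • 1 + b • I := by
  have : FiniteDimensional ℝ V := Module.finite_of_finrank_pos (by omega)
  obtain ⟨e, he, -⟩ := h.exists_neg
  obtain ⟨x, y, z, hx, hy, hz, hxy, hxz, hyz⟩ := h.exists_isHermOrtho_triple hd
  obtain ⟨v, hv, hcomm⟩ := exists_neg_forall_commute_lineFlip (I := I) ⟨e, he⟩ T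
  exact ⟨v, hv, fun i hi =>
    h.exists_eq_smul_one_add_smul hx hy hz hxy hxz hyz (hcomm i hi)⟩

end Genericity

theorem det_eq_one_of_mul_self_eq_neg_one {V : Type*} [AddCommGroup V] [Module ℝ V]
    {J : Module.End ℝ V} (hJ : J * J = -1) :
    LinearMap.det J = 1 := by
  have hdet_sq : LinearMap.det J * LinearMap.det J = (-1) ^ Module.finrank ℝ V := by
    rw [← map_mul, hJ, ← neg_one_smul ℝ (1 : Module.End ℝ V), LinearMap.det_smul, map_one, mul_one]
  have hsq : (1 + J) * (1 + J) = (2 : ℝ) • J := by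
    rw [add_mul, mul_add, mul_add, hJ, two_smul, one_mul, one_mul, mul_one]
    abel
  have hnonneg : 0 ≤ LinearMap.det J := by
    have hprod := mul_self_nonneg (LinearMap.det (1 + J))
    rw [← map_mul, hsq, LinearMap.det_smul] at hprod
    exact nonneg_of_mul_nonneg_right hprod (by positivity)
  rcases neg_one_pow_eq_or ℝ (Module.finrank ℝ V) with h | h <;> rw [h] at hdet_sq <;> nlinarith

section Lattice

theorem isSymmPosDef_of_isOrthoᵢ {ι F V : Type*} [Finite ι] [Field F] [LinearOrder F]
    [IsStrictOrderedRing F] [AddCommGroup V] [Module F V] {B : LinearMap.BilinForm F V}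
    (hB : B.IsSymm) {b : Module.Basis ι F V} (hb : B.IsOrthoᵢ b) (hpos : ∀ i, 0 < B (b i) (b i)) :
    IsSymmPosDef B := by
  have := Fintype.ofFinite ι
  refine ⟨hB, fun x hx => ?_⟩
  have hsum : B x x = ∑ i, b.repr x i ^ 2 * B (b i) (b i) := by
    conv_lhs => rw [← b.sum_repr x]
    simp only [map_sum, map_smul, LinearMap.sum_apply, LinearMap.smul_apply, smul_eq_mul]
    refine Finset.sum_congr rfl fun i _ => ?_
    rw [Finset.sum_eq_single i (fun j _ hji => by simp [hb hji]) (by simp)]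
    ring
  obtain ⟨i, hi⟩ : ∃ i, b.repr x i ≠ 0 := by
    by_contra! hzero
    exact hx (b.repr.map_eq_zero_iff.1 (Finsupp.ext hzero))
  rw [hsum]
  exact Finset.sum_pos' (fun j _ => mul_nonneg (sq_nonneg _) (hpos j).le)
    ⟨i, Finset.mem_univ _, mul_pos (by positivity) (hpos i)⟩

theorem isSymm_baseChange {R A L : Type*} [CommRing R] [CommRing A] [Algebra R A] [AddCommGroup L]
    [Module R L] {S : LinearMap.BilinForm R L} (hS : S.IsSymm) : (S.baseChange A).IsSymm :=
  ⟨(LinearMap.BilinForm.IsSymm.baseChange A ⟨hS.eq⟩).eq⟩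

theorem exists_isOrthoᵢ_ne_zero {R L : Type*} [CommRing R] [IsDomain R] [CharZero R]
    [AddCommGroup L] [Module R L] [Module.Free R L] [Module.Finite R L]
    {S : LinearMap.BilinForm R L} (hS : S.IsSymm) :
    ∃ b : Fin (Module.finrank R L) → L, S.IsOrthoᵢ b ∧ ∀ i, b i ≠ 0 := by
  let K := FractionRing R
  let : Invertible (2 : K) := invertibleOfNonzero two_ne_zero
  have hbasis := LinearMap.BilinForm.exists_orthogonal_basis
    (LinearMap.BilinForm.IsSymm.baseChange K ⟨hS.eq⟩)
  rw [Module.finrank_baseChange] at hbasis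
  obtain ⟨v, hv⟩ := hbasis
  choose p hp using fun i =>
    IsLocalizedModule.surj (nonZeroDivisors R) (TensorProduct.mk R K L 1) (v i)
  have hscale (i) : (1 : K) ⊗ₜ[R] (p i).1 = algebraMap R K (p i).2 • v i := by
    rw [algebraMap_smul]
    exact (hp i).symm
  refine ⟨fun i => (p i).1, fun i j hij => ?_, fun i (hi : (p i).1 = 0) => ?_⟩
  · have hortho : S.baseChange K (1 ⊗ₜ (p i).1) (1 ⊗ₜ (p j).1) = 0 := by
      rw [hscale, hscale, map_smul, map_smul, LinearMap.smul_apply, hv hij, smul_zero, smul_zero]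
    simpa [Algebra.smul_def] using hortho
  · have hzero := hscale i
    rw [hi, TensorProduct.tmul_zero, eq_comm, smul_eq_zero] at hzero
    exact hzero.elim (by simp) (v.ne_zero i)

theorem IsSymmPosDef.baseChange {R L : Type*} [CommRing R] [LinearOrder R] [IsStrictOrderedRing R]
    [AddCommGroup L] [Module R L] [Module.Free R L] [Module.Finite R L]
    {S : LinearMap.BilinForm R L} (hS : IsSymmPosDef S) (F : Type*) [Field F] [LinearOrder F]
    [IsStrictOrderedRing F] [Algebra R F] [SMulPosStrictMono R F] :
    IsSymmPosDef (S.baseChange F) := by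
  obtain ⟨b, hb, hb0⟩ := exists_isOrthoᵢ_ne_zero hS.1
  have hinner (i j) : S.baseChange F (1 ⊗ₜ b i) (1 ⊗ₜ b j) = algebraMap R F (S (b i) (b j)) := by
    simp [Algebra.algebraMap_eq_smul_one]
  have hortho : (S.baseChange F).IsOrthoᵢ fun i => (1 : F) ⊗ₜ[R] b i := fun i j hij => by
    change S.baseChange F (1 ⊗ₜ b i) (1 ⊗ₜ b j) = 0
    rw [hinner, hb hij, map_zero]
  have hpos (i) : 0 < S.baseChange F (1 ⊗ₜ b i) (1 ⊗ₜ b i) := by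
    rw [hinner]
    exact algebraMap_pos F (hS.2 _ (hb0 i))
  have hli := LinearMap.linearIndependent_of_isOrthoᵢ hortho fun i => (hpos i).ne'
  have hspan := hli.span_eq_top_of_card_eq_finrank'
    (by rw [Fintype.card_fin, Module.finrank_baseChange])
  exact isSymmPosDef_of_isOrthoᵢ (isSymm_baseChange hS.1)
    (b := Module.Basis.mk hli hspan.ge) (by simpa using hortho) (by simpa using hpos)

end Lattice

section OrthogonalSum

namespace IsHermitianPair

variable {𝕜 V : Type*} [Field 𝕜] [AddCommGroup V] [Module 𝕜 V]
  {B : LinearMap.BilinForm 𝕜 V} {I : Module.End 𝕜 V}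

theorem apply_self_eq_zero_of_finrank_eq_two [CharZero 𝕜] (h : IsHermitianPair B I)
    (hd : Module.finrank 𝕜 V = 2) {v w : V} (hv : B v v ≠ 0) (hvw : IsHermOrtho B I v w) :
    B w w = 0 := by
  by_contra hw
  have hwv := h.isHermOrtho_symm hvw
  have hwIv : B w (I v) = 0 := by rw [h.apply_right, hwv.2, neg_zero]
  have hortho : B.IsOrthoᵢ ![v, I v, w] := fun i j hij => by
    change B _ _ = 0
    fin_cases i <;> fin_cases j <;>
      simp_all [h.apply_left_self, h.apply_right_self, hvw.1, hvw.2, hwv.1]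
  have hli := LinearMap.linearIndependent_of_isOrthoᵢ hortho fun i => by
    fin_cases i <;> simp_all [h.isometry]
  have : FiniteDimensional 𝕜 V := Module.finite_of_finrank_pos (by omega)
  have hcard := hli.fintype_card_le_finrank
  rw [hd, Fintype.card_fin] at hcard
  omega

end IsHermitianPair

section OrderedField

variable {𝕜 V₁ V₂ : Type*} [Field 𝕜] [LinearOrder 𝕜] [AddCommGroup V₁] [Module 𝕜 V₁]
  [AddCommGroup V₂] [Module 𝕜 V₂]

theorem IsLorentzian.of_linearEquiv {B₁ : LinearMap.BilinForm 𝕜 V₁}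
    {B₂ : LinearMap.BilinForm 𝕜 V₂} {I₁ : Module.End 𝕜 V₁} {I₂ : Module.End 𝕜 V₂}
    (h : IsLorentzian B₂ I₂) (e : V₁ ≃ₗ[𝕜] V₂) (hB : ∀ x y, B₂ (e x) (e y) = B₁ x y)
    (hI : ∀ x, e (I₁ x) = I₂ (e x)) : IsLorentzian B₁ I₁ where
  symm := ⟨fun x y => by rw [← hB, h.symm.eq, hB]⟩
  sq := LinearMap.ext fun x => e.injective (by simp [hI, h.apply_apply])
  isometry x y := by rw [← hB, hI, hI, h.isometry, hB]
  exists_neg := by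
    obtain ⟨v, hv, hpos⟩ := h.exists_neg
    obtain ⟨v, rfl⟩ := e.surjective v
    refine ⟨v, (hB v v).symm.trans_lt hv, fun y hy hy0 => ?_⟩
    rw [← hB]
    exact hpos (e y) ⟨by rw [hB, hy.1], by rw [← hI, hB, hy.2]⟩ (e.map_ne_zero_iff.2 hy0)

theorem isLorentzian_orthogonalSum [IsStrictOrderedRing 𝕜] {B₁ : LinearMap.BilinForm 𝕜 V₁}
    {B₂ : LinearMap.BilinForm 𝕜 V₂} {I₁ : Module.End 𝕜 V₁} {I₂ : Module.End 𝕜 V₂}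
    (hd : Module.finrank 𝕜 V₁ = 2) (hB₁ : IsSymmPosDef B₁) (hB₂ : IsSymmPosDef B₂)
    (hI₁ : ∀ x y, B₁ (I₁ x) (I₁ y) = B₁ x y) (hI₂ : ∀ x y, B₂ (I₂ x) (I₂ y) = B₂ x y)
    (hsq₁ : I₁ * I₁ = -1) (hsq₂ : I₂ * I₂ = -1) :
    IsLorentzian (orthogonalSum (-B₁) B₂) (I₁.prodMap I₂) where
  symm := ⟨fun x y => by simp [orthogonalSum, hB₁.1.eq x.1, hB₂.1.eq x.2]⟩
  sq := by
    rw [LinearMap.prodMap_mul, hsq₁, hsq₂]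
    ext <;> simp
  isometry x y := by simp [orthogonalSum, hI₁, hI₂]
  exists_neg := by
    have : Nontrivial V₁ := Module.nontrivial_of_finrank_pos (R := 𝕜) (by omega)
    obtain ⟨x, hx⟩ := exists_ne (0 : V₁)
    refine ⟨(x, 0), by simpa [orthogonalSum] using hB₁.2 x hx, fun ⟨y₁, y₂⟩ hy hy0 => ?_⟩
    have hxy : IsHermOrtho B₁ I₁ x y₁ := by simpa [orthogonalSum, IsHermOrtho] using hy
    have hy₁ : y₁ = 0 := by
      by_contra hne
      have h₁ : IsHermitianPair B₁ I₁ := ⟨hB₁.1, hsq₁, hI₁⟩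
      exact (hB₁.2 y₁ hne).ne'
        (h₁.apply_self_eq_zero_of_finrank_eq_two hd (hB₁.2 x hx).ne' hxy)
    subst hy₁
    simpa [orthogonalSum] using hB₂.2 y₂ (by simpa using hy0)

end OrderedField

theorem orthogonalSum_baseChange_apply {R A L₁ L₂ : Type*} [CommRing R] [CommRing A] [Algebra R A]
    [AddCommGroup L₁] [Module R L₁] [AddCommGroup L₂] [Module R L₂] (S₁ : LinearMap.BilinForm R L₁)
    (S₂ : LinearMap.BilinForm R L₂) (x y : A ⊗[R] (L₁ × L₂)) :
    orthogonalSum (S₁.baseChange A) (S₂.baseChange A)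
      (TensorProduct.prodRight R A A L₁ L₂ x) (TensorProduct.prodRight R A A L₁ L₂ y) =
        (orthogonalSum S₁ S₂).baseChange A x y := by
  induction x with
  | zero => simp
  | add x x' hx hx' => simp only [map_add, LinearMap.add_apply, hx, hx']
  | tmul a x =>
    induction y with
    | zero => simp
    | add y y' hy hy' => simp only [map_add, hy, hy']
    | tmul b y => simp [orthogonalSum, add_smul]

theorem prodRight_baseChange_prodMap {R A L₁ L₂ : Type*} [CommRing R] [CommRing A] [Algebra R A]
    [AddCommGroup L₁] [Module R L₁] [AddCommGroup L₂] [Module R L₂] (J₁ : Module.End R L₁)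
    (J₂ : Module.End R L₂) (x : A ⊗[R] (L₁ × L₂)) :
    TensorProduct.prodRight R A A L₁ L₂ ((J₁.prodMap J₂).baseChange A x) =
      (J₁.baseChange A).prodMap (J₂.baseChange A) (TensorProduct.prodRight R A A L₁ L₂ x) := by
  induction x with
  | zero => simp only [map_zero]
  | add x x' hx hx' => simp only [map_add, hx, hx']
  | tmul a x => simp

theorem baseChange_neg {R A L : Type*} [CommRing R] [CommRing A] [Algebra R A] [AddCommGroup L]
    [Module R L] (S : LinearMap.BilinForm R L) : (-S).baseChange A = -S.baseChange A := by
  ext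
  simp

theorem baseChange_mul_self {R A L : Type*} [CommRing R] [CommRing A] [Algebra R A]
    [AddCommGroup L] [Module R L] {J : Module.End R L} (hJ : J * J = -1) :
    J.baseChange A * J.baseChange A = -1 := by
  rw [← LinearMap.baseChange_mul, hJ, LinearMap.baseChange_neg]
  simp

theorem isLorentzian_baseChange_orthogonalSum {R 𝕜 L₁ L₂ : Type*} [CommRing R] [LinearOrder R]
    [IsStrictOrderedRing R] [Field 𝕜] [LinearOrder 𝕜] [IsStrictOrderedRing 𝕜] [Algebra R 𝕜]
    [SMulPosStrictMono R 𝕜] [AddCommGroup L₁] [Module R L₁] [Module.Free R L₁] [Module.Finite R L₁]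
    [AddCommGroup L₂] [Module R L₂] [Module.Free R L₂] [Module.Finite R L₂]
    (hd : Module.finrank R L₁ = 2) {S₁ : LinearMap.BilinForm R L₁} {S₂ : LinearMap.BilinForm R L₂}
    (hS₁ : IsSymmPosDef S₁) (hS₂ : IsSymmPosDef S₂) {J₁ : Module.End R L₁} {J₂ : Module.End R L₂}
    (hJ₁ : ∀ x y, S₁.baseChange 𝕜 (J₁.baseChange 𝕜 x) (J₁.baseChange 𝕜 y) = S₁.baseChange 𝕜 x y)
    (hJ₂ : ∀ x y, S₂.baseChange 𝕜 (J₂.baseChange 𝕜 x) (J₂.baseChange 𝕜 y) = S₂.baseChange 𝕜 x y)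
    (hsq₁ : J₁ * J₁ = -1) (hsq₂ : J₂ * J₂ = -1) :
    IsLorentzian ((orthogonalSum (-S₁) S₂).baseChange 𝕜) ((J₁.prodMap J₂).baseChange 𝕜) :=
  have hsum := isLorentzian_orthogonalSum (by rw [Module.finrank_baseChange, hd])
    (hS₁.baseChange 𝕜) (hS₂.baseChange 𝕜) hJ₁ hJ₂ (baseChange_mul_self hsq₁)
    (baseChange_mul_self hsq₂)
  hsum.of_linearEquiv (TensorProduct.prodRight R 𝕜 𝕜 L₁ L₂)
    (fun x y => by rw [← baseChange_neg, orthogonalSum_baseChange_apply])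
    (prodRight_baseChange_prodMap J₁ J₂)

end OrthogonalSum

section Descent

theorem countable_end {k M : Type*} [Field k] [Countable k] [AddCommGroup M] [Module k M]
    [FiniteDimensional k M] : Countable (Module.End k M) :=
  have : Countable (Matrix (Fin (Module.finrank k M)) (Fin (Module.finrank k M)) k) :=
    inferInstanceAs (Countable (_ → _ → k))
  (LinearMap.toMatrix (Module.finBasis k M) (Module.finBasis k M)).injective.countable

theorem exists_eq_smul_one_add_smul_of_baseChange {k F M : Type*} [Field k] [Field F] [Algebra k F]
    [AddCommGroup M] [Module k M] {u T : Module.End k M} {a b : F}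
    (hu : u.baseChange F = a • 1 + b • T.baseChange F) : ∃ p q : k, u = p • 1 + q • T := by
  obtain ⟨ρ, hρ⟩ := LinearMap.exists_leftInverse_of_injective (Algebra.linearMap k F)
    (LinearMap.ker_eq_bot.2 (algebraMap k F).injective)
  have hρ_one : ρ 1 = 1 := by simpa using LinearMap.congr_fun hρ 1
  refine ⟨ρ a, ρ b, LinearMap.ext fun m => ?_⟩
  have hum := congrArg (TensorProduct.lid k M ∘ ρ.rTensor M) (LinearMap.congr_fun hu (1 ⊗ₜ m))
  simpa [TensorProduct.smul_tmul', hρ_one] using hum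

variable {L : Type*} [AddCommGroup L]

theorem ratEndToReal_baseChange (K : Module.End ℤ L) :
    ratEndToReal (K.baseChange ℚ) = K.baseChange ℝ := by
  ext x
  simp [ratEndToReal]

theorem ratEndToReal_smul_one_add_smul (a b : ℚ) (u : Module.End ℚ (ℚ ⊗[ℤ] L)) :
    ratEndToReal (a • 1 + b • u) = (a : ℝ) • 1 + (b : ℝ) • ratEndToReal u := by
  rw [ratEndToReal, LinearMap.baseChange_add, LinearMap.baseChange_smul, LinearMap.baseChange_smul,
    LinearMap.baseChange_one, ← Rat.cast_smul_eq_qsmul ℝ, ← Rat.cast_smul_eq_qsmul ℝ, map_add,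
    map_smul, map_smul, ratEndToReal, Module.End.one_eq_id, LinearEquiv.conj_id,
    ← Module.End.one_eq_id]

theorem exists_rat_eq_smul_one_add_smul {K : Module.End ℤ L} {u : Module.End ℚ (ℚ ⊗[ℤ] L)}
    {a b : ℝ} (hu : ratEndToReal u = a • 1 + b • K.baseChange ℝ) :
    ∃ p q : ℚ, u = p • 1 + q • K.baseChange ℚ := by
  refine exists_eq_smul_one_add_smul_of_baseChange (F := ℝ) (a := a) (b := b) ?_
  apply (TensorProduct.AlgebraTensorModule.cancelBaseChange ℤ ℚ ℝ ℝ L).conj.injective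
  rw [map_add, map_smul, map_smul, Module.End.one_eq_id, LinearEquiv.conj_id]
  exact hu.trans (by rw [← ratEndToReal_baseChange]; rfl)

end Descent

theorem mainTheorem6_general {L : Type*} [AddCommGroup L] [Module.Finite ℤ L]
    {S : LinearMap.BilinForm ℤ L} {K : Module.End ℤ L}
    (h : IsLorentzian (S.baseChange ℝ) (K.baseChange ℝ))
    (hd : 5 ≤ Module.finrank ℝ (ℝ ⊗[ℤ] L)) :
    ∃ J : Module.End ℝ (ℝ ⊗[ℤ] L),
      J ∈ specialOrthogonalSet (S.baseChange ℝ) ∧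
      J * J = -1 ∧
      rationalCentraliser J =
        {u | ∃ a b : ℚ, u = a • (1 : Module.End ℚ (ℚ ⊗[ℤ] L)) + b • K.baseChange ℚ} ∧
      IsSymmPosDef ((S.baseChange ℝ).compl₁₂ J (K.baseChange ℝ)) := by
  have : Countable (Module.End ℚ (ℚ ⊗[ℤ] L)) := countable_end
  obtain ⟨v, hv, hgeneric⟩ := h.exists_neg_forall_eq_smul_one_add_smul hd
    (ratEndToReal : Module.End ℚ (ℚ ⊗[ℤ] L) → _)
  have hsq := h.lineFlip_mul_self hv.ne
  refine ⟨lineFlip _ _ v, ⟨h.lineFlip_isometry hv.ne, det_eq_one_of_mul_self_eq_neg_one hsq⟩,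
    hsq, Set.Subset.antisymm ?_ ?_, h.isSymmPosDef_lineFlip hv⟩
  · intro u hu
    obtain ⟨a, b, hab⟩ := hgeneric u hu
    exact exists_rat_eq_smul_one_add_smul hab
  · rintro _ ⟨a, b, rfl⟩
    change Commute _ _
    rw [ratEndToReal_smul_one_add_smul, ratEndToReal_baseChange]
    exact ((Commute.one_left _).smul_left _).add_left ((h.lineFlip_commute v).smul_left _)

theorem mainTheorem6 (g : ℕ) (hg : 3 ≤ g)
    {Λ₁ Λ₂ : Type*} [AddCommGroup Λ₁] [AddCommGroup Λ₂]
    [Module.Free ℤ Λ₁] [Module.Finite ℤ Λ₁] [Module.Free ℤ Λ₂] [Module.Finite ℤ Λ₂]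
    (hΛ₁ : Module.finrank ℤ Λ₁ = 2) (hΛ₂ : Module.finrank ℤ Λ₂ = 2 * g - 2)
    (S₁ : LinearMap.BilinForm ℤ Λ₁) (S₂ : LinearMap.BilinForm ℤ Λ₂)
    (hS₁ : IsSymmPosDef S₁) (hS₂ : IsSymmPosDef S₂)
    (J₁ : Module.End ℤ Λ₁) (J₂ : Module.End ℤ Λ₂)
    (hJ₁ : J₁.baseChange ℝ ∈ specialOrthogonalSet (S₁.baseChange ℝ))
    (hJ₂ : J₂.baseChange ℝ ∈ specialOrthogonalSet (S₂.baseChange ℝ))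
    (hJ₁sq : J₁ * J₁ = -1) (hJ₂sq : J₂ * J₂ = -1)
    (S : LinearMap.BilinForm ℤ (Λ₁ × Λ₂)) (hS : S = orthogonalSum (-S₁) S₂)
    (J₀ : Module.End ℤ (Λ₁ × Λ₂)) (hJ₀ : J₀ = J₁.prodMap J₂) :
    ∃ J : Module.End ℝ (ℝ ⊗[ℤ] (Λ₁ × Λ₂)),
      J ∈ specialOrthogonalSet (S.baseChange ℝ) ∧
      J * J = -1 ∧
      rationalCentraliser J =
        {u | ∃ a b : ℚ, u = a • (1 : Module.End ℚ (ℚ ⊗[ℤ] (Λ₁ × Λ₂))) +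
          b • J₀.baseChange ℚ} ∧
      IsSymmPosDef ((S.baseChange ℝ).compl₁₂ J (J₀.baseChange ℝ)) := by
  subst hS hJ₀
  refine mainTheorem6_general
    (isLorentzian_baseChange_orthogonalSum hΛ₁ hS₁ hS₂ hJ₁.1 hJ₂.1 hJ₁sq hJ₂sq) ?_
  rw [Module.finrank_baseChange, Module.finrank_prod]
  omega
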